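/- Work over the field $\mathbb{C}$ of complex numbers; points of varieties are closed points. Let $X$ and $Y$ be irreducible projective varieties, let $S$ be an irreducible quasi-projective variety, and let $F : X \times S \to Y$ be a morphism of varieties over $\mathbb{C}$. For a point $s \in S$ write $F_s : X \to Y$ for the restriction of $F$ to $X \times \{s\} \cong X$. Assume that $F_s$ is a finite morphism for every $s \in S$, and let $s_0 \in S$ be a point such that $F_{s_0}$ is birational onto its image. Then there is an open subset $U \subseteq S$ with $s_0 \in U$ such that for every $s \in U$ the morphism $F_s$ is birational onto its image. (A morphism $f : X \to Y$ is birational onto its image if the induced morphism from $X$ to the closed subvariety $f(X) \subseteq Y$, with its reduced structure, restricts to an isomorphism from a dense open subset of $X$ onto a dense open subset of $f(X)$.) -/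

import Mathlib

open AlgebraicGeometry CategoryTheory CategoryTheory.Limits

noncomputable section

namespace ComplexVariety

attribute [local instance] MvPolynomial.gradedAlgebra

/-- The base scheme `Spec ℂ`. -/
abbrev SpecC : Scheme.{0} := Spec (CommRingCat.of ℂ)

/-- Complex projective `n`-space, `Proj ℂ[x₀, …, xₙ]` for the grading by total degree. -/
def ProjSpace (n : ℕ) : Scheme.{0} :=
  Proj (MvPolynomial.homogeneousSubmodule (Fin (n + 1)) ℂ)

/-- The structure morphism `ℙⁿ ⟶ Spec ℂ`: the canonical morphism from `Proj` to the spectrum of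
the degree-zero part, followed by `ℂ → ℂ[x₀, …, xₙ]₀` (constant polynomials) on spectra. -/
def ProjSpace.toSpecC (n : ℕ) : ProjSpace n ⟶ SpecC :=
  Proj.toSpecZero (MvPolynomial.homogeneousSubmodule (Fin (n + 1)) ℂ) ≫
    Spec.map (CommRingCat.ofHom
      (algebraMap ℂ (MvPolynomial.homogeneousSubmodule (Fin (n + 1)) ℂ 0)))

/-- A scheme over `ℂ` is an irreducible projective variety if it is integral and admits a
closed immersion over `ℂ` into some projective space. -/
structure IsIrreducibleProjective {X : Scheme.{0}} (pX : X ⟶ SpecC) : Prop where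
  isIntegral : IsIntegral X
  exists_closedImmersion :
    ∃ (n : ℕ) (i : X ⟶ ProjSpace n), IsClosedImmersion i ∧ i ≫ ProjSpace.toSpecC n = pX

/-- A scheme over `ℂ` is an irreducible quasi-projective variety if it is integral and admits a
(locally closed) immersion over `ℂ` into some projective space. -/
structure IsIrreducibleQuasiProjective {X : Scheme.{0}} (pX : X ⟶ SpecC) : Prop where
  isIntegral : IsIntegral X
  exists_immersion :
    ∃ (n : ℕ) (i : X ⟶ ProjSpace n), IsImmersion i ∧ i ≫ ProjSpace.toSpecC n = pX

/-- The points of the variety `S` over `ℂ`, as sections of its structure morphism. (For schemes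
of finite type over `ℂ` these correspond bijectively to the closed points of `S`.) -/
def Pt {S : Scheme.{0}} (pS : S ⟶ SpecC) : Type :=
  { s : SpecC ⟶ S // s ≫ pS = 𝟙 SpecC }

/-- The point of the underlying topological space of `S` given by a `ℂ`-point. -/
def Pt.point {S : Scheme.{0}} {pS : S ⟶ SpecC} (s : Pt pS) : S :=
  s.1 (IsLocalRing.closedPoint ℂ)

/-- The inclusion `X ≅ X × {s} ⟶ X × S`. -/
def sliceIncl {X S : Scheme.{0}} (pX : X ⟶ SpecC) {pS : S ⟶ SpecC} (s : Pt pS) :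
    X ⟶ pullback pX pS :=
  pullback.lift (𝟙 X) (pX ≫ s.1) (by rw [Category.assoc, s.2, Category.id_comp, Category.comp_id])

/-- The restriction `F_s = F|_{X × {s}} : X ⟶ Y` of `F : X × S ⟶ Y`. -/
def slice {X Y S : Scheme.{0}} {pX : X ⟶ SpecC} {pS : S ⟶ SpecC}
    (F : pullback pX pS ⟶ Y) (s : Pt pS) : X ⟶ Y :=
  sliceIncl pX s ≫ F

/-- A morphism is birational if it restricts to an isomorphism between a dense open subscheme of
the source and a dense open subscheme of the target. -/
def IsBirationalMorphism {X Y : Scheme.{0}} (f : X ⟶ Y) : Prop :=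
  ∃ φ : Scheme.PartialIso X Y, φ.iso.hom ≫ φ.target.ι = φ.source.ι ≫ f

/-- A morphism `f : X ⟶ Y` is birational onto its image if the induced morphism from `X` to the
scheme-theoretic image of `f` is birational. (For `X` integral and `f` finite, the
scheme-theoretic image is the closed subset `f(X)` with its reduced structure.) -/
def IsBirationalOntoImage {X Y : Scheme.{0}} (f : X ⟶ Y) : Prop :=
  IsBirationalMorphism f.toImage

end ComplexVariety

end

/-! Let `G = (F, pr₂) : X × S ⟶ Y × S`. It is proper, and its base change to `Y × {s}` is `F_s`. For
these morphisms, being birational onto the image amounts to being a closed immersion over some open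
subset of the target that meets the image. So `F_{s₀}` is a closed immersion near some `F_{s₀}(x₀)`.
This spreads from the slice to `G` (`exists_isClosedImmersion_morphismRestrict`): the fibre of `G`
there is one point, so `G` is finite nearby, and Nakayama makes `O → G_* O` surjective nearby. If
`G` is a closed immersion over an open `W`, then `F_s` is one over the slice `W_s`, and `W_s` meets
the image of `F_s` exactly when `s` lies in `pr₂(G⁻¹ W)`, which is open. -/

/-- Nakayama: a finite algebra `A` over `R` with `A = R + IA` satisfies `rA ⊆ R` for some
`r ∈ 1 + I`. -/
lemma Ideal.exists_sub_one_mem_forall_algebraMap_mul_mem_range {R A : Type*} [CommRing R]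
    [CommRing A] [Algebra R A] [Module.Finite R A] (I : Ideal R)
    (h : ∀ b : A, ∃ a : R, b - algebraMap R A a ∈ I.map (algebraMap R A)) :
    ∃ r : R, r - 1 ∈ I ∧ ∀ b : A, ∃ a : R, algebraMap R A a = algebraMap R A r * b := by
  set N := LinearMap.range (Algebra.linearMap R A)
  have hle : (⊤ : Submodule R (A ⧸ N)) ≤ I • ⊤ := by
    rintro x -
    obtain ⟨b, rfl⟩ := N.mkQ_surjective x
    obtain ⟨a, ha⟩ := h b
    have hmem : b - algebraMap R A a ∈ (I • ⊤ : Submodule R A) := by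
      rw [Ideal.smul_top_eq_map]
      exact ha
    have h0 : N.mkQ (algebraMap R A a) = 0 := by
      rw [Submodule.mkQ_apply, Submodule.Quotient.mk_eq_zero]
      exact ⟨a, rfl⟩
    have := Submodule.mem_map_of_mem (f := N.mkQ) hmem
    rw [Submodule.map_smul'', Submodule.map_top, Submodule.range_mkQ, map_sub, h0, sub_zero] at this
    exact this
  obtain ⟨r, hr, hr'⟩ := Submodule.exists_sub_one_mem_and_smul_eq_zero_of_fg_of_le_smul I
    (⊤ : Submodule R (A ⧸ N)) Module.Finite.fg_top hle
  refine ⟨r, hr, fun b ↦ ?_⟩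
  have := hr' (N.mkQ b) trivial
  rw [← map_smul, Submodule.mkQ_apply, Submodule.Quotient.mk_eq_zero, Algebra.smul_def] at this
  exact this

lemma IsLocalization.Away.surjective_map_of_mul_mem_range {R A R' A' : Type*} [CommRing R]
    [CommRing A] [CommRing R'] [CommRing A'] [Algebra R R'] [Algebra A A'] (φ : R →+* A) (r : R)
    [IsLocalization.Away r R'] [IsLocalization.Away (φ r) A']
    (h : ∀ b, ∃ a, φ a = φ r * b) : Function.Surjective (IsLocalization.Away.map R' A' φ r) := by
  intro y
  obtain ⟨⟨b, ⟨_, n, rfl⟩⟩, hb⟩ := IsLocalization.surj (Submonoid.powers (φ r)) y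
  obtain ⟨a, ha⟩ := h b
  -- As `φ a = φ r * b`, the fraction `b / φ(r)ⁿ` is the image of `a / rⁿ⁺¹`.
  refine ⟨IsLocalization.mk' R' a (⟨r ^ (n + 1), n + 1, rfl⟩ : Submonoid.powers r), ?_⟩
  rw [IsLocalization.Away.map, IsLocalization.map_mk', IsLocalization.mk'_eq_iff_eq_mul]
  simp only [ha, map_mul, map_pow, ← hb]
  ring

lemma CommRingCat.surjective_comp_of_isIso {A B C : CommRingCat.{0}} (f : A ⟶ B) (g : B ⟶ C)
    [IsIso g] (hf : Function.Surjective f) : Function.Surjective (f ≫ g) := by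
  have : ⇑(f ≫ g) = g ∘ f := by ext; simp
  rw [this]
  exact (ConcreteCategory.bijective_of_isIso g).2.comp hf

/-- With `I = ker ψ`, the pushout `A'` is `A / IA`, so surjectivity of `φ'` says `A = R + IA`, as
Nakayama requires. -/
lemma CommRingCat.exists_map_eq_one_forall_mul_mem_range_of_isPushout {R A R' A' : CommRingCat.{0}}
    {φ : R ⟶ A} {ψ : R ⟶ R'} {ψ' : A ⟶ A'} {φ' : R' ⟶ A'} (h : IsPushout φ ψ ψ' φ')
    (hφ : φ.hom.Finite) (hψ : Function.Surjective ψ) (hφ' : Function.Surjective φ') :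
    ∃ r : R, ψ r = 1 ∧ ∀ b : A, ∃ a : R, φ a = φ r * b := by
  algebraize [φ.hom]
  set I := RingHom.ker ψ.hom
  -- The universal property gives a map `A' → A / IA` compatible with the quotient map of `A`.
  have hker : ∀ b : A, ψ' b = 0 → b ∈ I.map φ.hom := by
    intro b hb
    let q : A ⟶ CommRingCat.of (A ⧸ I.map φ.hom) := CommRingCat.ofHom (Ideal.Quotient.mk _)
    have hq : RingHom.ker ψ.hom ≤ RingHom.ker (φ ≫ q).hom := by
      intro x hx
      rw [RingHom.mem_ker]
      exact Ideal.Quotient.eq_zero_iff_mem.mpr (Ideal.mem_map_of_mem _ hx)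
    let t : R' ⟶ CommRingCat.of (A ⧸ I.map φ.hom) :=
      CommRingCat.ofHom (ψ.hom.liftOfSurjective hψ ⟨_, hq⟩)
    have ht : φ ≫ q = ψ ≫ t := by
      ext x
      exact (RingHom.liftOfRightInverse_comp_apply ψ.hom _ (Function.rightInverse_surjInv hψ) ⟨_, hq⟩ x).symm
    have := congr($(h.inl_desc q t ht).hom b)
    rw [CommRingCat.hom_comp, RingHom.comp_apply, hb, map_zero] at this
    exact Ideal.Quotient.eq_zero_iff_mem.mp this.symm
  obtain ⟨r, hr, hr'⟩ := Ideal.exists_sub_one_mem_forall_algebraMap_mul_mem_range (A := A) I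
    (fun b ↦ by
      obtain ⟨x, hx⟩ := hφ' (ψ' b)
      obtain ⟨a, rfl⟩ := hψ x
      refine ⟨a, hker _ ?_⟩
      have := congr($(h.w).hom a)
      rw [map_sub, sub_eq_zero, ← hx]
      exact this.symm)
  refine ⟨r, ?_, hr'⟩
  rwa [RingHom.mem_ker, map_sub, map_one, sub_eq_zero] at hr

/-! ### Spreading out closed immersions; birational morphisms -/

namespace AlgebraicGeometry

/-- If sections on the target become surjective after multiplication by `r`, then the morphism is a
closed immersion over the locus where `r` is invertible. -/
lemma isClosedImmersion_morphismRestrict_basicOpen {P Q : Scheme.{0}} [IsAffine P] [IsAffine Q]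
    (G : P ⟶ Q) (r : Γ(Q, ⊤)) (hr : ∀ b, ∃ a, G.appTop a = G.appTop r * b) :
    IsClosedImmersion (G ∣_ Q.basicOpen r) := by
  have hQ := (isAffineOpen_top Q).isLocalization_basicOpen r
  have hP := (isAffineOpen_top P).isLocalization_basicOpen (G.appTop r)
  have : IsAffine (Q.basicOpen r) := (isAffineOpen_top Q).basicOpen r
  have : IsAffine (G ⁻¹ᵁ Q.basicOpen r) := ((isAffineOpen_top Q).basicOpen r).preimage G
  apply IsClosedImmersion.of_surjective_of_isAffine
  rw [morphismRestrict_appTop]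
  have hsurj : Function.Surjective (G.app ((Q.basicOpen r).ι ''ᵁ ⊤)) := by
    rw [Scheme.Opens.ι_image_top, (isAffineOpen_top Q).app_basicOpen_eq_away_map G
      (show IsAffineOpen (G ⁻¹ᵁ ⊤) from isAffineOpen_top P)]
    have hP' : IsLocalization.Away ((G.app ⊤).hom r) Γ(P, P.basicOpen (G.app ⊤ r)) := hP
    refine @CommRingCat.surjective_comp_of_isIso _ _ _ _ _ (Functor.map_isIso P.presheaf _) ?_
    exact IsLocalization.Away.surjective_map_of_mul_mem_range (R' := Γ(Q, Q.basicOpen r))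
      (A' := Γ(P, P.basicOpen (G.app ⊤ r))) (G.app ⊤).hom r hr
  exact @CommRingCat.surjective_comp_of_isIso _ _ _ _ _ (Functor.map_isIso P.presheaf _) hsurj

lemma exists_isClosedImmersion_morphismRestrict_of_isAffine {P Q P' Q' : Scheme.{0}}
    [IsAffine Q] {c' : P' ⟶ P} {G' : P' ⟶ Q'} {G : P ⟶ Q} {c : Q' ⟶ Q}
    (h : IsPullback c' G' G c) [IsFinite G] [IsClosedImmersion c] [IsClosedImmersion G'] (q : Q') :
    ∃ U : Q.Opens, c q ∈ U ∧ IsClosedImmersion (G ∣_ U) := by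
  have : IsAffine P := isAffine_of_isAffineHom G
  obtain ⟨_, hc⟩ := IsClosedImmersion.isAffine_surjective_of_isAffine c
  obtain ⟨_, hG'⟩ := IsClosedImmersion.isAffine_surjective_of_isAffine G'
  obtain ⟨r, hr, hr'⟩ := CommRingCat.exists_map_eq_one_forall_mul_mem_range_of_isPushout
    (isPushout_appTop_of_isPullback h) G.finite_appTop hc hG'
  -- `r` restricts to `1` on `Q'`, so its basic open contains all of `c(Q')`.
  refine ⟨Q.basicOpen r, ?_, isClosedImmersion_morphismRestrict_basicOpen G r hr'⟩
  change q ∈ c ⁻¹ᵁ Q.basicOpen r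
  rw [Scheme.preimage_basicOpen_top, hr]
  simp

lemma Scheme.Hom.quasiFiniteAt_of_subsingleton_preimage {P Q : Scheme.{0}} {G : P ⟶ Q}
    [LocallyOfFiniteType G] {z : P} (h : (G ⁻¹' {G z}).Subsingleton) : G.QuasiFiniteAt z := by
  rw [Scheme.Hom.quasiFiniteAt_iff_isOpen_singleton_asFiber]
  have : Subsingleton (G ⁻¹' {G z}) := h.coe_sort
  have : Subsingleton (G.fiber (G z)) := (G.fiberHomeo (G z)).injective.subsingleton
  have : ({G.asFiber z} : Set (G.fiber (G z))) = Set.univ :=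
    Set.eq_univ_of_forall fun x ↦ Subsingleton.elim _ _
  rw [this]
  exact isOpen_univ

/-- A proper morphism is finite over a neighbourhood of any point with at most one preimage. -/
lemma exists_isFinite_morphismRestrict_of_subsingleton_preimage {P Q : Scheme.{0}} (G : P ⟶ Q)
    [IsProper G] {y : Q} (h : (G ⁻¹' {y}).Subsingleton) :
    ∃ W : Q.Opens, y ∈ W ∧ IsFinite (G ∣_ W) := by
  -- The complement of the image of the non-quasi-finite locus, open because `G` is closed; over it,
  -- proper and quasi-finite give finite.
  let W : Q.Opens := ⟨(G '' (G.quasiFiniteLocus : Set P)ᶜ)ᶜ,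
    (G.isClosedMap _ G.quasiFiniteLocus.isOpen.isClosed_compl).isOpen_compl⟩
  have hW : G ⁻¹ᵁ W ≤ G.quasiFiniteLocus := by
    intro z hz
    by_contra hz'
    exact hz ⟨z, hz', rfl⟩
  refine ⟨W, ?_, ?_⟩
  · rintro ⟨z, hz, rfl⟩
    exact hz (Scheme.Hom.quasiFiniteAt_of_subsingleton_preimage h)
  · have : LocallyQuasiFinite (G ∣_ W) := by
      rw [← LocallyQuasiFinite.comp_iff _ W.ι, morphismRestrict_ι, ← P.homOfLE_ι hW, Category.assoc]
      infer_instance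
    exact .of_isProper_of_locallyQuasiFinite _

/-- For `U` with preimage contained in `W'`, the base change of `G` to the preimage of `U` is a
closed immersion if the base change of `G` is one over `W'`. -/
lemma isClosedImmersion_pullback_snd_morphismRestrict {P Q P' Q' : Scheme.{0}}
    {c' : P' ⟶ P} {G' : P' ⟶ Q'} {G : P ⟶ Q} {c : Q' ⟶ Q} (h : IsPullback c' G' G c)
    {W' : Q'.Opens} [IsClosedImmersion (G' ∣_ W')] {U : Q.Opens} (hU : c ⁻¹ᵁ U ≤ W') :
    IsClosedImmersion (pullback.snd (G ∣_ U) (c ∣_ U)) := by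
  have h₁ := (IsPullback.of_hasPullback (G ∣_ U) (c ∣_ U)).paste_horiz
    (isPullback_morphismRestrict G U).flip
  rw [morphismRestrict_ι, ← Q'.homOfLE_ι hU, Category.assoc] at h₁
  have h₂ := (isPullback_morphismRestrict G' W').flip.paste_horiz h
  exact MorphismProperty.of_isPullback (P := @IsClosedImmersion) (IsPullback.of_right' h₁ h₂) ‹_›

lemma subsingleton_preimage_of_isClosedImmersion_morphismRestrict {P Q : Scheme.{0}} (G : P ⟶ Q)
    (W : Q.Opens) [IsClosedImmersion (G ∣_ W)] {q : Q} (hq : q ∈ W) :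
    (G ⁻¹' {q}).Subsingleton := by
  rintro x rfl y hy
  have hx' : x ∈ G ⁻¹ᵁ W := hq
  have hy' : y ∈ G ⁻¹ᵁ W := by
    change G y ∈ W
    rwa [show G y = G x from hy]
  have : (⟨x, hx'⟩ : G ⁻¹ᵁ W) = ⟨y, hy'⟩ := by
    apply (G ∣_ W).isClosedEmbedding.injective
    exact Subtype.ext <| (morphismRestrict_base_coe G W ⟨x, hx'⟩).trans <|
      (show G x = G y from hy.symm).trans (morphismRestrict_base_coe G W ⟨y, hy'⟩).symm
  exact congr($(this).1)

/-- If the base change of a proper morphism to a closed subscheme is a closed immersion near a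
point, then so is the morphism itself. -/
theorem exists_isClosedImmersion_morphismRestrict {P Q P' Q' : Scheme.{0}}
    {c' : P' ⟶ P} {G' : P' ⟶ Q'} {G : P ⟶ Q} {c : Q' ⟶ Q} (h : IsPullback c' G' G c)
    [IsProper G] [IsClosedImmersion c] (W' : Q'.Opens) [IsClosedImmersion (G' ∣_ W')]
    {q : Q'} (hq : q ∈ W') :
    ∃ U : Q.Opens, c q ∈ U ∧ IsClosedImmersion (G ∣_ U) := by
  -- Points of `P` over `c q` lift to points of `P'` over `q`, and there is at most one of those.
  have hsub : (G ⁻¹' {c q}).Subsingleton := by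
    intro x hx y hy
    obtain ⟨x', rfl, hx'⟩ := Scheme.exists_preimage_of_isPullback h x q hx
    obtain ⟨y', rfl, hy'⟩ := Scheme.exists_preimage_of_isPullback h y q hy
    rw [subsingleton_preimage_of_isClosedImmersion_morphismRestrict G' W' hq hx' hy']
  obtain ⟨W, hqW, _⟩ := exists_isFinite_morphismRestrict_of_subsingleton_preimage G hsub
  obtain ⟨T, hT, hT'⟩ := c.isClosedEmbedding.isInducing.isOpen_iff.mp W'.isOpen
  have hqT : c q ∈ T := by
    change q ∈ c ⁻¹' T
    rw [hT']
    exact hq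
  obtain ⟨_, ⟨U, hU, rfl⟩, hqU, hUT⟩ := Q.isBasis_affineOpens.exists_subset_of_mem_open
    (show c q ∈ T ∩ W from ⟨hqT, hqW⟩) (hT.inter W.isOpen)
  have : IsAffine U := hU
  have hUW' : c ⁻¹ᵁ U ≤ W' := fun x hx ↦ hT'.subset (hUT hx).1
  have : IsFinite (G ∣_ U) := by
    have h₁ := (isPullback_morphismRestrict G U).flip
    rw [← Q.homOfLE_ι (show U ≤ W from fun x hx ↦ (hUT hx).2)] at h₁
    exact MorphismProperty.of_isPullback (P := @IsFinite)
      (IsPullback.of_right' h₁ (isPullback_morphismRestrict G W).flip) ‹_›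
  have := isClosedImmersion_pullback_snd_morphismRestrict h hUW'
  obtain ⟨V, hV, hV'⟩ := exists_isClosedImmersion_morphismRestrict_of_isAffine
    (IsPullback.of_hasPullback (G ∣_ U) (c ∣_ U)) ⟨q, hqU⟩
  refine ⟨Scheme.Opens.ι U ''ᵁ V, ⟨_, hV, morphismRestrict_base_coe c U _⟩, ?_⟩
  exact (MorphismProperty.arrow_mk_iso_iff @IsClosedImmersion (morphismRestrictRestrict G U V)).mp
    hV'

/-- This makes the image of a reduced scheme reduced, so that a surjective closed immersion into an
open part of it is an isomorphism. -/
instance {X Y : Scheme.{0}} (f : X ⟶ Y) [QuasiCompact f] :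
    IsSchemeTheoreticallyDominant f.toImage := by
  rw [isSchemeTheoreticallyDominant_iff]
  refine Scheme.IdealSheafData.ext_of_iSup_eq_top (ι := Y.affineOpens)
    (fun U ↦ ⟨f.imageι ⁻¹ᵁ U, U.2.preimage f.imageι⟩) ?_ fun U ↦ ?_
  · rw [← Scheme.Hom.preimage_iSup, iSup_affineOpens_eq_top]
    rfl
  · rw [Scheme.Hom.ker_apply, Scheme.IdealSheafData.ideal_bot, Pi.bot_apply,
      ← RingHom.injective_iff_ker_eq_bot]
    exact f.toImage_app_injective U

/-- The source of a birational morphism `f` is the whole preimage of the target. -/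
lemma isIso_morphismRestrict_partialIso_target {X Z : Scheme.{0}} (f : X ⟶ Z) [IsSeparated f]
    (φ : X.PartialIso Z) (h : φ.iso.hom ≫ φ.target.ι = φ.source.ι ≫ f) :
    IsIso (f ∣_ φ.target) := by
  have hle : φ.source ≤ f ⁻¹ᵁ φ.target := by
    intro x hx
    let x' : φ.source.toScheme := ⟨x, hx⟩
    have h' : φ.target.ι (φ.iso.hom x') = f x :=
      (Scheme.Hom.comp_apply φ.iso.hom φ.target.ι x').symm.trans congr($h x')
    change f x ∈ φ.target
    rw [← h']
    exact (φ.iso.hom x').2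
  set j := X.homOfLE hle
  have hj : j ≫ f ∣_ φ.target = φ.iso.hom := by
    rw [← cancel_mono φ.target.ι, Category.assoc, morphismRestrict_ι, X.homOfLE_ι_assoc, h]
  -- Separatedness of `f` makes `j` a closed immersion; it is also open and dominant, hence an
  -- isomorphism.
  have : IsClosedImmersion (j ≫ f ∣_ φ.target) := by rw [hj]; infer_instance
  have : IsClosedImmersion j := .of_comp j (f ∣_ φ.target)
  have : IsDominant φ.source.ι := Opens.isDominant_ι φ.dense_source
  have : IsDominant (j ≫ (f ⁻¹ᵁ φ.target).ι) := by rw [X.homOfLE_ι]; infer_instance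
  have : IsDominant j := .of_comp_of_isOpenImmersion j (f ⁻¹ᵁ φ.target).ι
  have : Surjective j :=
    surjective_of_isDominant_of_isClosed_range _ j.isClosedEmbedding.isClosed_range
  have : IsIso j := (isIso_iff_isOpenImmersion_and_surjective j).mpr ⟨inferInstance, ‹_›⟩
  have : IsIso (j ≫ f ∣_ φ.target) := by rw [hj]; infer_instance
  exact IsIso.of_isIso_comp_left j _

end AlgebraicGeometry

/-! ### Birationality onto the image, and slices of `X × S` -/

namespace ComplexVariety

lemma IsBirationalOntoImage.exists_isClosedImmersion_morphismRestrict {X Y : Scheme.{0}}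
    [Nonempty X] {f : X ⟶ Y} [QuasiCompact f] [IsSeparated f] (h : IsBirationalOntoImage f) :
    ∃ W : Y.Opens, IsClosedImmersion (f ∣_ W) ∧ ∃ x, f x ∈ W := by
  obtain ⟨φ, hφ⟩ := h
  have : IsSeparated (f.toImage ≫ f.imageι) := by rw [f.toImage_imageι]; infer_instance
  have : IsSeparated f.toImage := .of_comp f.toImage f.imageι
  have := isIso_morphismRestrict_partialIso_target f.toImage φ hφ
  obtain ⟨T, hT, hT'⟩ := f.imageι.isClosedEmbedding.isInducing.isOpen_iff.mp φ.target.isOpen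
  obtain ⟨W, hW⟩ : ∃ W : Y.Opens, f.imageι ⁻¹ᵁ W = φ.target :=
    ⟨⟨T, hT⟩, TopologicalSpace.Opens.ext hT'⟩
  refine ⟨W, ?_, ?_⟩
  · have : IsIso (f.toImage ∣_ (f.imageι ⁻¹ᵁ W)) := by rwa [hW]
    have h : IsClosedImmersion ((f.toImage ≫ f.imageι) ∣_ W) := by
      rw [morphismRestrict_comp]
      exact @IsClosedImmersion.comp _ _ _ _ _
        (inferInstanceAs (IsClosedImmersion (f.toImage ∣_ (f.imageι ⁻¹ᵁ W))))
        (inferInstanceAs (IsClosedImmersion (f.imageι ∣_ W)))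
    rwa [f.toImage_imageι] at h
  · obtain ⟨x, hx⟩ := f.toImage.denseRange.exists_mem_open φ.target.isOpen
      (φ.dense_target.nonempty_iff.mpr (Nonempty.map f.toImage ‹_›))
    refine ⟨x, ?_⟩
    rw [← f.toImage_imageι, Scheme.Hom.comp_apply]
    change f.toImage x ∈ f.imageι ⁻¹ᵁ W
    rwa [hW]

/-- Over `W` the map to the image is a closed immersion, dominant and thus surjective, with reduced
target. Irreducibility of `X` gives density. -/
lemma IsBirationalOntoImage.of_isClosedImmersion_morphismRestrict {X Y : Scheme.{0}}
    [IsIntegral X] {f : X ⟶ Y} [QuasiCompact f] (W : Y.Opens) [IsClosedImmersion (f ∣_ W)]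
    {x : X} (hx : f x ∈ W) : IsBirationalOntoImage f := by
  set g := f.toImage
  set V := f.imageι ⁻¹ᵁ W
  have hxV : g x ∈ V := by
    change f.imageι (f.toImage x) ∈ W
    rwa [← Scheme.Hom.comp_apply, f.toImage_imageι]
  have hcomp : ∀ f' : X ⟶ Y, f' = f → IsClosedImmersion (f' ∣_ W) := by
    rintro _ rfl
    infer_instance
  have : IsClosedImmersion (g ∣_ V ≫ f.imageι ∣_ W) := by
    have := hcomp _ f.toImage_imageι
    rwa [morphismRestrict_comp] at this
  have : IsClosedImmersion (g ∣_ V) := .of_comp _ (f.imageι ∣_ W)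
  have : IsReduced f.image := IsSchemeTheoreticallyDominant.isReduced g
  have : IsDominant (g ∣_ V) := IsZariskiLocalAtTarget.restrict (P := @IsDominant) inferInstance V
  have : Surjective (g ∣_ V) :=
    surjective_of_isDominant_of_isClosed_range _ (g ∣_ V).isClosedEmbedding.isClosed_range
  have : IsIso (g ∣_ V) := isIso_of_isClosedImmersion_of_surjective _
  have hd : Dense (g ⁻¹ᵁ V : Set X) := (g ⁻¹ᵁ V).isOpen.dense ⟨x, hxV⟩
  refine ⟨⟨g ⁻¹ᵁ V, hd, V, ?_, asIso (g ∣_ V)⟩, morphismRestrict_ι g V⟩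
  exact (g.denseRange.dense_image g.continuous hd).mono (Set.image_preimage_subset _ _)

attribute [local instance] MvPolynomial.gradedAlgebra

instance isProper_projSpace_toSpecC (n : ℕ) : IsProper (ProjSpace.toSpecC n) := by
  have : IsScalarTower ℂ (MvPolynomial.homogeneousSubmodule (Fin (n + 1)) ℂ 0)
      (MvPolynomial (Fin (n + 1)) ℂ) := ⟨fun a b c ↦ smul_mul_assoc a b.1 c⟩
  have : Algebra.FiniteType (MvPolynomial.homogeneousSubmodule (Fin (n + 1)) ℂ 0)
      (MvPolynomial (Fin (n + 1)) ℂ) := .of_restrictScalars_finiteType ℂ _ _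
  have : IsClosedImmersion (Spec.map (CommRingCat.ofHom
      (algebraMap ℂ (MvPolynomial.homogeneousSubmodule (Fin (n + 1)) ℂ 0)))) := by
    refine IsClosedImmersion.spec_of_surjective _ fun p ↦ ?_
    have hp : p.1.totalDegree = 0 := Nat.le_zero.mp
      ((MvPolynomial.mem_homogeneousSubmodule _ _).mp p.2).totalDegree_le
    exact ⟨_, Subtype.ext (MvPolynomial.totalDegree_eq_zero_iff_eq_C.mp hp).symm⟩
  have : IsProper (Proj.toSpecZero (MvPolynomial.homogeneousSubmodule (Fin (n + 1)) ℂ)) :=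
    inferInstance
  exact MorphismProperty.comp_mem @IsProper _ _ this inferInstance

lemma IsIrreducibleProjective.isProper {X : Scheme.{0}} {pX : X ⟶ SpecC}
    (h : IsIrreducibleProjective pX) : IsProper pX := by
  obtain ⟨n, i, _, rfl⟩ := h.exists_closedImmersion
  infer_instance

variable {X Y S : Scheme.{0}} {pX : X ⟶ SpecC} {pY : Y ⟶ SpecC} {pS : S ⟶ SpecC}

lemma Pt.isClosedImmersion (s : Pt pS) : IsClosedImmersion s.1 :=
  isClosedImmersion_of_comp_eq_id pS s.1 s.2

lemma isPullback_sliceIncl (pX : X ⟶ SpecC) (s : Pt pS) :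
    IsPullback (sliceIncl pX s) pX (pullback.snd pX pS) s.1 := by
  refine IsPullback.of_right ?_ (by rw [sliceIncl, pullback.lift_snd])
    (IsPullback.of_hasPullback pX pS)
  rw [sliceIncl, pullback.lift_fst, s.2]
  exact .of_horiz_isIso ⟨by simp⟩

/-- The morphism `(F, pr₂) : X × S ⟶ Y × S`. -/
noncomputable def graphOver (F : pullback pX pS ⟶ Y) (hF : F ≫ pY = pullback.fst pX pS ≫ pX) :
    pullback pX pS ⟶ pullback pY pS :=
  pullback.lift F (pullback.snd pX pS) (hF.trans pullback.condition)

/-- Both slices are pullbacks of `s` along the projections to `S`, and pullback squares cancel. -/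
lemma isPullback_graphOver (F : pullback pX pS ⟶ Y) (hF : F ≫ pY = pullback.fst pX pS ≫ pX)
    (s : Pt pS) :
    IsPullback (sliceIncl pX s) (slice F s) (graphOver F hF) (sliceIncl pY s) := by
  have : slice F s ≫ pY = pX := by
    rw [slice, Category.assoc, hF, sliceIncl, pullback.lift_fst_assoc, Category.id_comp]
  refine .of_bot (t := isPullback_sliceIncl pY s) ?_ ?_
  · rw [this, graphOver, pullback.lift_snd]
    exact isPullback_sliceIncl pX s
  · have h₁ := (isPullback_sliceIncl pX s).w
    have h₂ := (isPullback_sliceIncl pY s).w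
    apply pullback.hom_ext
    · rw [Category.assoc, Category.assoc, graphOver, pullback.lift_fst, sliceIncl, sliceIncl,
        pullback.lift_fst, Category.comp_id, slice, sliceIncl]
    · rw [Category.assoc, Category.assoc, graphOver, pullback.lift_snd, h₁, h₂, reassoc_of% this]

lemma isProper_graphOver [IsProper pX] [IsSeparated pY] (F : pullback pX pS ⟶ Y)
    (hF : F ≫ pY = pullback.fst pX pS ≫ pX) : IsProper (graphOver F hF) := by
  have : IsProper (graphOver F hF ≫ pullback.snd pY pS) := by
    rw [graphOver, pullback.lift_snd]
    infer_instance
  exact .of_comp _ (pullback.snd pY pS)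

end ComplexVariety

theorem mainTheorem7
    {X Y S : Scheme.{0}}
    (pX : X ⟶ ComplexVariety.SpecC) (pY : Y ⟶ ComplexVariety.SpecC) (pS : S ⟶ ComplexVariety.SpecC)
    (hX : ComplexVariety.IsIrreducibleProjective pX)
    (hY : ComplexVariety.IsIrreducibleProjective pY)
    (hS : ComplexVariety.IsIrreducibleQuasiProjective pS)
    (F : pullback pX pS ⟶ Y) (hF : F ≫ pY = pullback.fst pX pS ≫ pX)
    (hfin : ∀ s : ComplexVariety.Pt pS, IsFinite (ComplexVariety.slice F s))
    (s₀ : ComplexVariety.Pt pS)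
    (hs₀ : ComplexVariety.IsBirationalOntoImage (ComplexVariety.slice F s₀)) :
    ∃ U : S.Opens, s₀.point ∈ U ∧
      ∀ s : ComplexVariety.Pt pS, s.point ∈ U →
        ComplexVariety.IsBirationalOntoImage (ComplexVariety.slice F s) := by
  have := hX.isIntegral
  have := hX.isProper
  have := hY.isProper
  have := hfin s₀
  have := ComplexVariety.isProper_graphOver F hF
  have hc := ComplexVariety.Pt.isClosedImmersion s₀
  have : IsClosedImmersion (ComplexVariety.sliceIncl pY s₀) :=
    MorphismProperty.of_isPullback (P := @IsClosedImmersion)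
      (ComplexVariety.isPullback_sliceIncl pY s₀).flip hc
  obtain ⟨W', _, x₀, hx₀⟩ := hs₀.exists_isClosedImmersion_morphismRestrict
  obtain ⟨W, hW, _⟩ := exists_isClosedImmersion_morphismRestrict
    (ComplexVariety.isPullback_graphOver F hF s₀) W' hx₀
  set G := ComplexVariety.graphOver F hF
  -- `pr₂` is open, being a base change of a morphism to the spectrum of a field.
  refine ⟨⟨pullback.snd pX pS '' (G ⁻¹ᵁ W), (pullback.snd pX pS).isOpenMap _ (G ⁻¹ᵁ W).isOpen⟩,
    ⟨ComplexVariety.sliceIncl pX s₀ x₀, ?_, ?_⟩, ?_⟩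
  · change G _ ∈ W
    rwa [← Scheme.Hom.comp_apply, (ComplexVariety.isPullback_graphOver F hF s₀).w]
  · rw [← Scheme.Hom.comp_apply, (ComplexVariety.isPullback_sliceIncl pX s₀).w,
      Scheme.Hom.comp_apply]
    exact congrArg s₀.1 (Subsingleton.elim _ _)
  · rintro s ⟨v, hv, hvs⟩
    -- A point of `G⁻¹ W` above `s` lies on the slice `X × {s}`, so `W_s` meets the image of `F_s`.
    obtain ⟨x, rfl, -⟩ := Scheme.exists_preimage_of_isPullback
      (ComplexVariety.isPullback_sliceIncl pX s) v _ hvs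
    have := hfin s
    have h := ComplexVariety.isPullback_graphOver F hF s
    have : IsClosedImmersion
        (ComplexVariety.slice F s ∣_ ComplexVariety.sliceIncl pY s ⁻¹ᵁ W) := by
      have h₁ := (isPullback_morphismRestrict (ComplexVariety.slice F s)
        (ComplexVariety.sliceIncl pY s ⁻¹ᵁ W)).flip.paste_horiz h
      rw [← morphismRestrict_ι] at h₁
      exact MorphismProperty.of_isPullback (P := @IsClosedImmersion)
        (IsPullback.of_right' h₁ (isPullback_morphismRestrict G W).flip) ‹_›
    refine ComplexVariety.IsBirationalOntoImage.of_isClosedImmersion_morphismRestrict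
      (ComplexVariety.sliceIncl pY s ⁻¹ᵁ W) (x := x) ?_
    change ComplexVariety.sliceIncl pY s (ComplexVariety.slice F s x) ∈ W
    rwa [← Scheme.Hom.comp_apply, ← h.w]
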